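/- Let $\mathbb S^1=\mathbb R/2\pi\mathbb Z$, let $\|\cdot\|$ be the norm of the real space $L^2(\mathbb S^1)$ (with arc length $dx$), and let $l>1/2$ be real. Let $\dot H^l(\mathbb S^1)$ be the space of real $f\in L^2(\mathbb S^1)$ with $\int_0^{2\pi}f\,dx=0$ that have a derivative $f^{(l)}\in L^2(\mathbb S^1)$ of order $l$; that is, the $k$-th Fourier coefficient of $f^{(l)}$ is $(ik)^l$ (principal branch) times that of $f$ for every $k\in\mathbb Z$. For integer $l$ this is the usual weak derivative. Let $$c(l)=\bigl(2l\,\alpha^\alpha(1-\alpha)^{1-\alpha}\sin\pi\alpha\bigr)^{-1},\qquad \alpha=\frac1{2l},$$ (Taikov's sharp constant), and let $K(l)$ (the correction constant) be the largest constant $K$ such that $$\|f\|_\infty^2\le c(l)\,\|f\|^{2-1/l}\,\|f^{(l)}\|^{1/l}-K\,\|f\|^2\qquad\text{for all } f\in\dot H^l(\mathbb S^1).$$ Then $K(l)>0$, and for every $N$ and all $\varphi_1,\dots,\varphi_N\in\dot H^l(\mathbb S^1)$ that are orthonormal in $L^2(\mathbb S^1)$, the function $\rho=\sum_{j=1}^N\varphi_j^2$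 satisfies $\rho^{2l+1}\in L^1(\mathbb S^1)$ and $$\int_0^{2\pi}\rho(x)^{2l+1}\,dx+N\cdot K(l)^{2l}\le c(l)^{2l}\sum_{j=1}^N\|\varphi_j^{(l)}\|^2 .$$ For $l=1$ we have $K(1)=1/\pi$, and the inequality reads $$\int_0^{2\pi}\rho(x)^3\,dx+\frac N{\pi^2}\le\sum_{j=1}^N\|\varphi_j'\|^2 .$$ -/

import Mathlib

open MeasureTheory
open scoped Real

noncomputable section

namespace LiebThirring

/-- The period `2π` is positive. -/
instance factTwoPiPos : Fact (0 < 2 * π) := ⟨Real.two_pi_pos⟩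

/-- The circle `𝕊¹ = ℝ / 2πℤ`. Its `volume` is arc length `dx`, of total mass `2π`. -/
abbrev Circ : Type := AddCircle (2 * π)

/-- The real Hilbert space `L²(𝕊¹)`, with inner product `∫₀^{2π} f g dx`. -/
abbrev L2Circ : Type := Lp ℝ 2 (volume : Measure Circ)

/-- `f` has mean value zero. -/
def MeanZero (f : L2Circ) : Prop := ∫ x : Circ, f x = 0

/-- `g = f^{(l)}` in `L²(𝕊¹)`, in the sense of periodic distributions: the `k`-th Fourier
coefficient of `g` is `(ik)^l` times that of `f`, for every integer `k`.

For `l = n` a positive integer this says that `∫ g ψ = (-1)^n ∫ f ψ^{(n)}` for `ψ(x) = e^{-ikx}`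
and all `k`, so `g` is the usual weak derivative of order `n` of the periodic function `f`.
For other `l > 0` (principal branch of the power) it is the Weyl derivative of order `l`,
whose `L²` norm is that of `(-d²/dx²)^{l/2} f`. -/
def IsDeriv (l : ℝ) (f g : L2Circ) : Prop :=
  ∀ k : ℤ, fourierCoeff (fun x : Circ => ((g x : ℝ) : ℂ)) k =
    (Complex.I * (k : ℂ)) ^ (l : ℂ) * fourierCoeff (fun x : Circ => ((f x : ℝ) : ℂ)) k

/-- `f` belongs to the Sobolev space of functions of order `l` with mean value zero, and
`f^{(l)} = g ∈ L²(𝕊¹)`. -/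
def InSobolev (l : ℝ) (f g : L2Circ) : Prop := MeanZero f ∧ IsDeriv l f g

/-- The sharp constant `c(l) = (2l α^α (1-α)^{1-α} sin(πα))⁻¹`, `α = 1/(2l)`. -/
def c (l : ℝ) : ℝ :=
  (2 * l * (1 / (2 * l)) ^ (1 / (2 * l)) * (1 - 1 / (2 * l)) ^ (1 - 1 / (2 * l)) *
    Real.sin (π * (1 / (2 * l))))⁻¹

/-- The inequality `‖f‖_∞² ≤ c(l) ‖f‖^{2-1/l} ‖f^{(l)}‖^{1/l} - κ ‖f‖²` holds for all `f` in the
Sobolev space of functions of order `l` with mean value zero. A bound for `‖f‖_∞²` is the same as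
a bound for `f(x)²` at almost every `x`. -/
def CorrectedIneq (l κ : ℝ) : Prop :=
  ∀ f g : L2Circ, InSobolev l f g →
    ∀ᵐ x : Circ, (f x) ^ 2 ≤ c l * ‖f‖ ^ (2 - 1 / l) * ‖g‖ ^ (1 / l) - κ * ‖f‖ ^ 2

/-- The sharp (largest) constant `K(l)` of the correction term. -/
def K (l : ℝ) : ℝ := sSup {κ : ℝ | CorrectedIneq l κ}

/-- `ρ(x) = ∑ⱼ φⱼ(x)²`. -/
def rho {N : ℕ} (φ : Fin N → L2Circ) (x : Circ) : ℝ := ∑ j, (φ j x) ^ 2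

end LiebThirring

end

noncomputable section

namespace LiebThirring

/-! ### Fourier coefficients of real square integrable functions -/

/-! At almost every `x` the corrected inequality holds for all combinations `∑ ξⱼ φⱼ` at once
(`ae_forall_sum_le`), so `ξⱼ = φⱼ(x)` is allowed. Orthonormality makes both the value at `x` and the
squared norm of this combination equal to `ρ(x)`, and the inequality becomes `(ρ + K) ρ^{1/(2l)} ≤
c(l) D^{1/l}` with `D = ‖∑ φⱼ(x) φⱼ^{(l)}‖`. The power `2l` together with `(ρ + K)^{2l} ≥ ρ^{2l} +
K^{2l}` bounds `ρ^{2l+1} + K^{2l} ρ` by `c(l)^{2l} D²`, and integration turns `D²` into `∑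
‖φⱼ^{(l)}‖²` (`integral_norm_sum_smul_sq`).

Positivity of `K(l)` comes from Cauchy–Schwarz on the Fourier side with weights `|k|^{2l} + μ`
(`InSobolev.ae_sq_le`). Replacing the resulting sum over `k ≥ 1` by an integral and optimising in
`μ` gives exactly `c(l)`; the sum is smaller than the integral by at least a multiple of `1/μ`
(`resolvent_sum_add_le_integral`), which leaves a positive correction.

For `l = 1` the sum has a closed form from the cotangent series (`resolventSum_one`). It yields
`K(1) ≥ 1/π` by a good choice of `μ`, and `K(1) ≤ 1/π` by testing truncated Green's functions, with
coefficients `(k² + a²)⁻¹`, and letting `a → ∞` (`CorrectedIneq.le_of_pos`). -/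

/-- The `k`-th Fourier coefficient of a real function in `L²(𝕊¹)`. -/
def coef (f : L2Circ) (k : ℤ) : ℂ := fourierCoeff (fun x : Circ => ((f x : ℝ) : ℂ)) k

lemma ae_haarAddCircle_eq :
    ae (AddCircle.haarAddCircle : Measure Circ) = ae (volume : Measure Circ) := by
  rw [AddCircle.volume_eq_smul_haarAddCircle, Measure.ae_ennreal_smul_measure_eq]
  simp [Real.pi_pos]

lemma memLp_ofReal (f : L2Circ) :
    MemLp (fun x : Circ => ((f x : ℝ) : ℂ)) 2 AddCircle.haarAddCircle :=
  memLp_haarAddCircle_iff.2 (Lp.memLp f).ofReal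

lemma integrable_ofReal (f : L2Circ) :
    Integrable (fun x : Circ => ((f x : ℝ) : ℂ)) AddCircle.haarAddCircle :=
  (memLp_ofReal f).integrable (by norm_num)

/-- The complexification of `f`, as an element of `L²` for the normalised Haar measure. -/
def complexify (f : L2Circ) : Lp ℂ 2 (AddCircle.haarAddCircle : Measure Circ) :=
  (memLp_ofReal f).toLp

lemma coeFn_complexify (f : L2Circ) :
    complexify f =ᵐ[AddCircle.haarAddCircle] fun x => ((f x : ℝ) : ℂ) :=
  (memLp_ofReal f).coeFn_toLp

lemma fourierCoeff_complexify (f : L2Circ) (k : ℤ) :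
    fourierCoeff (complexify f) k = coef f k := by
  rw [fourierCoeff_congr_ae (coeFn_complexify f), coef]

lemma norm_sq_eq_integral (f : L2Circ) : ‖f‖ ^ 2 = ∫ x : Circ, (f x) ^ 2 := by
  rw [← real_inner_self_eq_norm_sq, L2.inner_def]
  exact integral_congr_ae (ae_of_all _ fun x => by simp [sq])

/-- Parseval. Coefficients are taken with normalised Haar measure but the norm with arc length,
hence the factor `2π`. -/
lemma hasSum_sq_coef (f : L2Circ) :
    HasSum (fun k => ‖coef f k‖ ^ 2) (‖f‖ ^ 2 / (2 * π)) := by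
  have h := hasSum_sq_fourierCoeff (complexify f)
  simp only [fourierCoeff_complexify] at h
  convert h using 1
  rw [integral_congr_ae (g := fun x => (f x) ^ 2), AddCircle.integral_haarAddCircle,
    norm_sq_eq_integral, smul_eq_mul, div_eq_inv_mul]
  filter_upwards [coeFn_complexify f] with x hx
  simp [hx]

lemma coef_add (f g : L2Circ) (k : ℤ) : coef (f + g) k = coef f k + coef g k := by
  have h : (fun x : Circ => (((f + g : L2Circ) x : ℝ) : ℂ)) =ᵐ[AddCircle.haarAddCircle]
      (fun x : Circ => ((f x : ℝ) : ℂ)) + fun x : Circ => ((g x : ℝ) : ℂ) := by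
    have := Lp.coeFn_add f g
    rw [Filter.EventuallyEq, ae_haarAddCircle_eq]
    filter_upwards [this] with x hx
    rw [hx]
    simp
  rw [coef, fourierCoeff_congr_ae h, fourierCoeff.add (integrable_ofReal f) (integrable_ofReal g)]
  rfl

lemma coef_smul (r : ℝ) (f : L2Circ) (k : ℤ) : coef (r • f) k = r * coef f k := by
  have h : (fun x : Circ => (((r • f : L2Circ) x : ℝ) : ℂ)) =ᵐ[AddCircle.haarAddCircle]
      fun x : Circ => (r : ℂ) * ((f x : ℝ) : ℂ) := by
    have := Lp.coeFn_smul r f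
    rw [Filter.EventuallyEq, ae_haarAddCircle_eq]
    filter_upwards [this] with x hx
    simp [hx]
  rw [coef, fourierCoeff_congr_ae h, fourierCoeff.const_mul]
  rfl

/-- The `k`-th Fourier coefficient as a real linear map. -/
def coefₗ (k : ℤ) : L2Circ →ₗ[ℝ] ℂ where
  toFun f := coef f k
  map_add' f g := coef_add f g k
  map_smul' r f := by simp [coef_smul]

lemma coef_sum_smul {ι : Type*} [Fintype ι] (ξ : ι → ℝ) (φ : ι → L2Circ) (k : ℤ) :
    coef (∑ j, ξ j • φ j) k = ∑ j, ξ j * coef (φ j) k := by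
  change coefₗ k _ = _
  rw [map_sum]
  exact Finset.sum_congr rfl fun j _ => coef_smul _ _ _

lemma meanZero_iff (f : L2Circ) : MeanZero f ↔ coef f 0 = 0 := by
  have : coef f 0 = (((2 * π)⁻¹ * ∫ x : Circ, f x : ℝ) : ℂ) := by
    rw [coef, fourierCoeff, AddCircle.integral_haarAddCircle]
    simp only [neg_zero, fourier_zero, one_smul, integral_complex_ofReal]
    simp
  rw [this, Complex.ofReal_eq_zero, mul_eq_zero, MeanZero]
  simp [Real.pi_ne_zero]

lemma InSobolev.sum_smul {ι : Type*} [Fintype ι] {l : ℝ} {φ dφ : ι → L2Circ}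
    (h : ∀ j, InSobolev l (φ j) (dφ j)) (ξ : ι → ℝ) :
    InSobolev l (∑ j, ξ j • φ j) (∑ j, ξ j • dφ j) := by
  refine ⟨?_, fun k => ?_⟩
  · rw [meanZero_iff, coef_sum_smul]
    exact Finset.sum_eq_zero fun j _ => by rw [(meanZero_iff _).1 (h j).1, mul_zero]
  · change coef _ k = _ * coef _ k
    rw [coef_sum_smul, coef_sum_smul, Finset.mul_sum]
    refine Finset.sum_congr rfl fun j _ => ?_
    have := (h j).2 k
    change coef _ k = _ * coef _ k at this
    rw [this]
    ring

lemma InSobolev.coef_zero {l : ℝ} {f g : L2Circ} (h : InSobolev l f g) : coef f 0 = 0 :=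
  (meanZero_iff f).1 h.1

lemma InSobolev.norm_coef {l : ℝ} {f g : L2Circ} (h : InSobolev l f g) (k : ℤ) :
    ‖coef g k‖ = |(k : ℝ)| ^ l * ‖coef f k‖ := by
  have := h.2 k
  change coef _ k = _ * coef _ k at this
  rw [this, norm_mul, Complex.norm_cpow_real]
  simp

/-- The sum of the absolute values of the Fourier coefficients bounds the function. -/
lemma ae_abs_le_tsum_norm_coef {f : L2Circ} (h : Summable fun k => ‖coef f k‖) :
    ∀ᵐ x : Circ, |f x| ≤ ∑' k, ‖coef f k‖ := by
  have hs : Summable fun k : ℤ => coef f k • (fourier k : C(Circ, ℂ)) :=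
    Summable.of_norm (by simpa [norm_smul, fourier_norm] using h)
  have h1 := (ContinuousMap.toLp (E := ℂ) 2 (AddCircle.haarAddCircle : Measure Circ) ℂ).hasSum
    hs.hasSum
  have h2 := hasSum_fourier_series_L2 (complexify f)
  simp only [fourierCoeff_complexify] at h2
  have h3 : ContinuousMap.toLp (E := ℂ) 2 (AddCircle.haarAddCircle : Measure Circ) ℂ
      (∑' k : ℤ, coef f k • (fourier k : C(Circ, ℂ))) = complexify f := by
    refine h1.unique ?_
    simpa [Function.comp_def, fourierLp] using h2
  have h4 := ContinuousMap.coeFn_toLp (𝕜 := ℂ) (p := 2) (AddCircle.haarAddCircle : Measure Circ)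
      (∑' k : ℤ, coef f k • (fourier k : C(Circ, ℂ)))
  rw [h3] at h4
  rw [← ae_haarAddCircle_eq]
  filter_upwards [h4, coeFn_complexify f] with x hx hx'
  rw [← Real.norm_eq_abs, ← Complex.norm_real, ← hx', hx]
  refine (ContinuousMap.norm_coe_le_norm _ x).trans ?_
  refine (norm_tsum_le_tsum_norm ?_).trans (le_of_eq ?_)
  · simpa [norm_smul, fourier_norm] using h
  · simp [norm_smul, fourier_norm]

/-! ### Trigonometric polynomials -/

/-- A trigonometric polynomial with conjugate symmetric coefficients is a real function with these
Fourier coefficients. -/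
lemma exists_trigPoly (s : Finset ℤ) (hs : ∀ k ∈ s, -k ∈ s) (a : ℤ → ℂ)
    (ha : ∀ k ∈ s, a (-k) = (starRingEnd ℂ) (a k)) :
    ∃ f : L2Circ, (∀ k, coef f k = if k ∈ s then a k else 0) ∧
      ∃ F : C(Circ, ℝ), f =ᵐ[volume] F ∧ F 0 = (∑ k ∈ s, a k).re := by
  let G : C(Circ, ℂ) := ∑ k ∈ s, a k • (fourier k : C(Circ, ℂ))
  have hG : ∀ x, G x = ∑ k ∈ s, a k * fourier k x := fun x => by simp [G]
  have hconj : ∀ x, (starRingEnd ℂ) (G x) = G x := by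
    intro x
    rw [hG, map_sum]
    refine Finset.sum_bij' (fun k _ => -k) (fun k _ => -k) (fun k hk => hs k hk)
      (fun k hk => hs k hk) (by simp) (by simp) fun k hk => ?_
    rw [map_mul, ha k hk, fourier_neg]
  let F : C(Circ, ℝ) := ⟨fun x => (G x).re, by fun_prop⟩
  have hFG : ∀ x, ((F x : ℝ) : ℂ) = G x := fun x => Complex.conj_eq_iff_re.1 (hconj x)
  have hF : (ContinuousMap.toLp (E := ℝ) 2 (volume : Measure Circ) ℝ F : L2Circ)
      =ᵐ[volume] F := ContinuousMap.coeFn_toLp _ _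
  refine ⟨ContinuousMap.toLp (E := ℝ) 2 volume ℝ F, fun k => ?_, F, hF, ?_⟩
  · rw [coef, fourierCoeff_congr_ae (g := ∑ j ∈ s, a j • (fourier j : Circ → ℂ)),
      fourierCoeff.sum]
    · rw [Finset.sum_apply]
      simp only [fourierCoeff.const_smul, fourierCoeff_fourier]
      simp [Pi.single_apply]
    · intro i _
      exact (((fourier i : C(Circ, ℂ)).continuous.integrable_of_hasCompactSupport
        (HasCompactSupport.of_compactSpace _))).smul _
    · rw [Filter.EventuallyEq, ae_haarAddCircle_eq]
      filter_upwards [hF] with x hx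
      rw [hx, hFG, hG]
      simp
  · change (G 0).re = _
    rw [hG]
    simp

/-! ### The pointwise bound -/

/-- The sum `∑_{k ≥ 1} (k^{2l} + μ)⁻¹`. -/
def resolventSum (l μ : ℝ) : ℝ := ∑' n : ℕ, (((n : ℝ) + 1) ^ (2 * l) + μ)⁻¹

lemma summable_resolvent {l μ : ℝ} (hl : 1 / 2 < l) (hμ : 0 ≤ μ) :
    Summable fun n : ℕ => (((n : ℝ) + 1) ^ (2 * l) + μ)⁻¹ := by
  have h : Summable fun n : ℕ => (((n : ℝ) + 1) ^ (2 * l))⁻¹ := by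
    have := (summable_nat_add_iff 1).2
      (Real.summable_nat_rpow_inv (p := 2 * l)|>.2 (by linarith))
    simpa using this
  refine h.of_nonneg_of_le (fun n => by positivity) fun n => ?_
  exact inv_anti₀ (by positivity) (by linarith)

lemma resolventSum_nonneg {l μ : ℝ} (hμ : 0 ≤ μ) : 0 ≤ resolventSum l μ :=
  tsum_nonneg fun n => by positivity

lemma hasSum_int_resolvent {l μ : ℝ} (hl : 1 / 2 < l) (hμ : 0 ≤ μ) :
    HasSum (fun k : ℤ => if k = 0 then 0 else (|(k : ℝ)| ^ (2 * l) + μ)⁻¹)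
      (2 * resolventSum l μ) := by
  have h : HasSum (fun n : ℕ => (((n : ℝ) + 1) ^ (2 * l) + μ)⁻¹) (resolventSum l μ) :=
    (summable_resolvent hl hμ).hasSum
  have habs : ∀ n : ℕ, |(n : ℝ) + 1| = n + 1 := fun n => abs_of_pos (by positivity)
  rw [two_mul (resolventSum l μ)]
  refine HasSum.of_nat_of_neg_add_one (f := fun k : ℤ =>
    if k = 0 then 0 else (|(k : ℝ)| ^ (2 * l) + μ)⁻¹) ?_ ?_
  · have h1 := (hasSum_nat_add_iff (f := fun n : ℕ =>
      if (n : ℤ) = 0 then 0 else (|((n : ℤ) : ℝ)| ^ (2 * l) + μ)⁻¹) (g := resolventSum l μ) 1).1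
    simp only [Finset.range_one, Finset.sum_singleton, Nat.cast_zero, if_true, add_zero] at h1
    refine h1 (h.congr_fun fun n => ?_)
    have h0 : ((n + 1 : ℕ) : ℤ) ≠ 0 := by positivity
    rw [if_neg h0]
    push_cast
    rw [habs]
  · refine h.congr_fun fun n => ?_
    have h0 : (-((n : ℤ) + 1)) ≠ 0 := neg_ne_zero.2 (by positivity)
    rw [if_neg h0]
    push_cast
    rw [abs_neg, habs]

lemma InSobolev.norm_coef_sq {l : ℝ} {f g : L2Circ} (h : InSobolev l f g) (k : ℤ) :
    ‖coef g k‖ ^ 2 = |(k : ℝ)| ^ (2 * l) * ‖coef f k‖ ^ 2 := by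
  rw [h.norm_coef, mul_pow, ← Real.rpow_natCast, ← Real.rpow_mul (abs_nonneg _)]
  congr 2
  push_cast
  ring

/-- Mean value zero leaves only frequencies `|k| ≥ 1`. -/
lemma InSobolev.norm_le {l : ℝ} (hl : 1 / 2 < l) {f g : L2Circ} (h : InSobolev l f g) :
    ‖f‖ ≤ ‖g‖ := by
  refine pow_le_pow_iff_left₀ (norm_nonneg _) (norm_nonneg _) two_ne_zero |>.1 ?_
  rw [← div_le_div_iff_of_pos_right (show 0 < 2 * π by positivity)]
  refine hasSum_le (fun k => ?_) (hasSum_sq_coef f) (hasSum_sq_coef g)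
  rcases eq_or_ne k 0 with rfl | hk
  · simp [h.coef_zero]
  · rw [h.norm_coef_sq]
    refine le_mul_of_one_le_left (by positivity) (Real.one_le_rpow ?_ (by linarith))
    exact_mod_cast Int.one_le_abs hk

/-- Cauchy–Schwarz for `∑ |f̂(k)|` with weights `|k|^{2l} + μ`: one factor is the resolvent sum over
`k ≠ 0`, the other is `‖g‖² + μ‖f‖²` up to `2π`. -/
lemma InSobolev.ae_sq_le {l μ : ℝ} (hl : 1 / 2 < l) (hμ : 0 < μ) {f g : L2Circ}
    (h : InSobolev l f g) :
    ∀ᵐ x : Circ, (f x) ^ 2 ≤ resolventSum l μ / π * (‖g‖ ^ 2 + μ * ‖f‖ ^ 2) := by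
  have hw : HasSum (fun k : ℤ => (|(k : ℝ)| ^ (2 * l) + μ) * ‖coef f k‖ ^ 2)
      ((‖g‖ ^ 2 + μ * ‖f‖ ^ 2) / (2 * π)) := by
    have := (hasSum_sq_coef g).add ((hasSum_sq_coef f).mul_left μ)
    convert this using 1
    · ext k
      rw [h.norm_coef_sq]
      ring
    · ring
  have hu := hasSum_int_resolvent hl hμ.le
  set U := 2 * resolventSum l μ with hU
  set W := (‖g‖ ^ 2 + μ * ‖f‖ ^ 2) / (2 * π) with hW
  have hU0 : 0 ≤ U := by have := resolventSum_nonneg (l := l) hμ.le; positivity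
  have hW0 : 0 ≤ W := by positivity
  have hu0 : ∀ k : ℤ, (0 : ℝ) ≤ if k = 0 then 0 else (|(k : ℝ)| ^ (2 * l) + μ)⁻¹ := fun k => by
    split_ifs <;> positivity
  have hfin : ∀ s : Finset ℤ, ∑ k ∈ s, ‖coef f k‖ ≤ √(U * W) := by
    intro s
    refine Real.le_sqrt_of_sq_le ?_
    refine (Finset.sum_sq_le_sum_mul_sum_of_sq_le_mul s
      (f := fun k : ℤ => if k = 0 then 0 else (|(k : ℝ)| ^ (2 * l) + μ)⁻¹)
      (g := fun k : ℤ => (|(k : ℝ)| ^ (2 * l) + μ) * ‖coef f k‖ ^ 2)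
      (fun k _ => hu0 k) (fun k _ => by positivity) fun k _ => ?_).trans ?_
    · rcases eq_or_ne k 0 with rfl | hk
      · simp [h.coef_zero]
      · have : |(k : ℝ)| ^ (2 * l) + μ ≠ 0 := by positivity
        simp only [hk, if_false]
        exact le_of_eq (by field_simp)
    · exact mul_le_mul (sum_le_hasSum s (fun k _ => hu0 k) hu)
        (sum_le_hasSum s (fun k _ => by positivity) hw)
        (Finset.sum_nonneg fun k _ => by positivity) hU0
  have hs : Summable fun k => ‖coef f k‖ :=
    summable_of_sum_le (fun _ => norm_nonneg _) hfin
  have ht : ∑' k, ‖coef f k‖ ≤ √(U * W) := hs.tsum_le_of_sum_le hfin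
  filter_upwards [ae_abs_le_tsum_norm_coef hs] with x hx
  calc (f x) ^ 2 = |f x| ^ 2 := (sq_abs _).symm
    _ ≤ √(U * W) ^ 2 := by gcongr; exact hx.trans ht
    _ = U * W := Real.sq_sqrt (by positivity)
    _ = _ := by rw [hU, hW]; field_simp

/-- Bounds on the resolvent sum that yield a correction term `κ`. -/
lemma correctedIneq_of_resolventSum {l κ : ℝ} (hl : 1 / 2 < l)
    (h : ∀ s : ℝ, 1 ≤ s → ∃ μ : ℝ, 0 < μ ∧
      resolventSum l μ / π * (s ^ 2 + μ) ≤ c l * s ^ (1 / l) - κ) :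
    CorrectedIneq l κ := by
  intro f g hfg
  have hl0 : 0 < l := by linarith
  rcases eq_or_ne f 0 with rfl | hf
  -- For `f = 0` the right side vanishes only because `0` is raised to a nonzero exponent.
  · have hne : 2 - 1 / l ≠ 0 := by
      have : 1 / l < 2 := by rw [div_lt_iff₀ hl0]; linarith
      linarith
    filter_upwards [Lp.coeFn_zero ℝ 2 (volume : Measure Circ)] with x hx
    rw [hx]
    simp [Real.zero_rpow (by simpa using hne : 2 - l⁻¹ ≠ 0)]
  have hf0 : 0 < ‖f‖ := norm_pos_iff.2 hf
  -- By homogeneity only the ratio `s = ‖g‖ / ‖f‖` matters, and `s ≥ 1` by `InSobolev.norm_le`.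
  obtain ⟨μ, hμ, hle⟩ := h (‖g‖ / ‖f‖) (by rw [le_div_iff₀ hf0, one_mul]; exact hfg.norm_le hl)
  filter_upwards [hfg.ae_sq_le hl hμ] with x hx
  refine hx.trans ?_
  have h1 := mul_le_mul_of_nonneg_right hle (sq_nonneg ‖f‖)
  have h2 : ‖f‖ ^ (2 - 1 / l) * ‖g‖ ^ (1 / l) = (‖g‖ / ‖f‖) ^ (1 / l) * ‖f‖ ^ 2 := by
    rw [Real.rpow_sub hf0, Real.div_rpow (norm_nonneg _) (norm_nonneg _), Real.rpow_two]
    ring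
  calc _ = resolventSum l μ / π * ((‖g‖ / ‖f‖) ^ 2 + μ) * ‖f‖ ^ 2 := by field_simp
    _ ≤ _ := h1
    _ = _ := by rw [mul_assoc (c l), h2]; ring

/-! ### The integral of the resolvent -/

lemma lintegral_exp_neg_mul {b : ℝ} (hb : 0 < b) :
    ∫⁻ t in Set.Ioi (0 : ℝ), ENNReal.ofReal (Real.exp (-b * t)) = ENNReal.ofReal b⁻¹ := by
  have hi := integrableOn_exp_mul_Ioi (neg_lt_zero.2 hb) 0
  rw [← ofReal_integral_eq_lintegral_ofReal hi (ae_of_all _ fun t => (Real.exp_pos _).le),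
    integral_exp_mul_Ioi (neg_lt_zero.2 hb)]
  simp

/-- Write `(x^p + μ)⁻¹` as `∫ exp(-(x^p + μ)t) dt` and swap by Tonelli; both integrals are Gamma
integrals, and the reflection formula produces the sine. -/
lemma lintegral_resolvent {p μ : ℝ} (hp : 1 < p) (hμ : 0 < μ) :
    ∫⁻ x in Set.Ioi (0 : ℝ), ENNReal.ofReal (x ^ p + μ)⁻¹ =
      ENNReal.ofReal (μ ^ (1 / p - 1) * (1 / p * (π / Real.sin (π * (1 / p))))) := by
  have hp0 : 0 < p := by linarith
  have hα : 1 / p < 1 := by rw [div_lt_one hp0]; exact hp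
  have hα0 : 0 < 1 / p := by positivity
  have hG1 : 0 < Real.Gamma (1 / p + 1) := Real.Gamma_pos_of_pos (by linarith)
  have hG2 : 0 < Real.Gamma (1 - 1 / p) := Real.Gamma_pos_of_pos (by linarith)
  have inner : ∀ t ∈ Set.Ioi (0 : ℝ),
      ∫⁻ x in Set.Ioi (0 : ℝ), ENNReal.ofReal (Real.exp (-(x ^ p + μ) * t)) =
      ENNReal.ofReal (Real.Gamma (1 / p + 1) *
        (t ^ (1 - 1 / p - 1) * Real.exp (-(μ * t)))) := by
    intro t ht
    have ht0 : (0 : ℝ) < t := ht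
    have h1 := integral_exp_neg_mul_rpow hp0 ht0
    have hpos : 0 < t ^ (-1 / p) * Real.Gamma (1 / p + 1) := by positivity
    -- A non-integrable function would have Bochner integral `0`, but the known value is positive.
    have hint : IntegrableOn (fun x => Real.exp (-t * x ^ p)) (Set.Ioi (0 : ℝ)) := by
      by_contra hcon
      rw [integral_undef hcon] at h1
      exact hpos.ne h1
    calc _ = ∫⁻ x in Set.Ioi (0 : ℝ), ENNReal.ofReal (Real.exp (-(μ * t))) *
          ENNReal.ofReal (Real.exp (-t * x ^ p)) := by
          refine lintegral_congr fun x => ?_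
          rw [← ENNReal.ofReal_mul (Real.exp_pos _).le, ← Real.exp_add]
          ring_nf
      _ = _ := by
          rw [lintegral_const_mul' _ _ ENNReal.ofReal_ne_top,
            ← ofReal_integral_eq_lintegral_ofReal hint (ae_of_all _ fun t => (Real.exp_pos _).le),
            h1, ← ENNReal.ofReal_mul (Real.exp_pos _).le,
            show -1 / p = 1 - 1 / p - 1 by ring]
          ring_nf
  calc _ = ∫⁻ x in Set.Ioi (0 : ℝ), ∫⁻ t in Set.Ioi (0 : ℝ),
        ENNReal.ofReal (Real.exp (-(x ^ p + μ) * t)) := by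
        refine setLIntegral_congr_fun measurableSet_Ioi fun x hx => ?_
        have hx0 : (0 : ℝ) < x := hx
        exact (lintegral_exp_neg_mul (by positivity)).symm
    _ = ∫⁻ t in Set.Ioi (0 : ℝ), ∫⁻ x in Set.Ioi (0 : ℝ),
        ENNReal.ofReal (Real.exp (-(x ^ p + μ) * t)) := by
        refine lintegral_lintegral_swap (Measurable.aemeasurable ?_)
        unfold Function.uncurry
        fun_prop
    _ = ∫⁻ t in Set.Ioi (0 : ℝ), ENNReal.ofReal (Real.Gamma (1 / p + 1) *
        (t ^ (1 - 1 / p - 1) * Real.exp (-(μ * t)))) :=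
        setLIntegral_congr_fun measurableSet_Ioi inner
    _ = _ := by
        have h2 := Real.integral_rpow_mul_exp_neg_mul_Ioi (a := 1 - 1 / p) (r := μ)
          (by linarith) hμ
        have hint : IntegrableOn (fun t : ℝ => t ^ (1 - 1 / p - 1) * Real.exp (-(μ * t)))
            (Set.Ioi 0) := by
          by_contra hcon
          rw [integral_undef hcon] at h2
          have : 0 < (1 / μ) ^ (1 - 1 / p) * Real.Gamma (1 - 1 / p) := by positivity
          exact this.ne h2
        rw [← ofReal_integral_eq_lintegral_ofReal (hint.const_mul _), integral_const_mul, h2]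
        · congr 1
          rw [Real.Gamma_add_one hα0.ne', ← Real.Gamma_mul_Gamma_one_sub, one_div μ,
            Real.inv_rpow hμ.le, ← Real.rpow_neg hμ.le, neg_sub]
          ring
        · refine (ae_restrict_iff' measurableSet_Ioi).2 (ae_of_all _ fun t ht => ?_)
          have ht0 : (0 : ℝ) < t := ht
          positivity

lemma sin_pi_div_pos {p : ℝ} (hp : 1 < p) : 0 < Real.sin (π * (1 / p)) := by
  have hp0 : 0 < p := by linarith
  refine Real.sin_pos_of_pos_of_lt_pi (by positivity) ?_
  have : 1 / p < 1 := by rw [div_lt_one hp0]; exact hp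
  nlinarith [Real.pi_pos]

lemma continuousOn_resolvent {p μ : ℝ} (hp : 1 < p) (hμ : 0 < μ) :
    ContinuousOn (fun x : ℝ => (x ^ p + μ)⁻¹) (Set.Ici 0) := by
  refine ContinuousOn.inv₀ ?_ fun x hx => ?_
  · exact (continuousOn_id.rpow_const fun x _ => Or.inr (by linarith)).add continuousOn_const
  · have hx0 : (0 : ℝ) ≤ x := hx
    positivity

lemma integrableOn_resolvent {p μ : ℝ} (hp : 1 < p) (hμ : 0 < μ) :
    IntegrableOn (fun x : ℝ => (x ^ p + μ)⁻¹) (Set.Ioi 0) := by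
  have hm : AEStronglyMeasurable (fun x : ℝ => (x ^ p + μ)⁻¹)
      (volume.restrict (Set.Ioi 0)) :=
    ((continuousOn_resolvent hp hμ).mono Set.Ioi_subset_Ici_self).aestronglyMeasurable
      measurableSet_Ioi
  refine (lintegral_ofReal_ne_top_iff_integrable hm ?_).1 ?_
  · refine (ae_restrict_iff' measurableSet_Ioi).2 (ae_of_all _ fun t ht => ?_)
    have ht0 : (0 : ℝ) < t := ht
    change 0 ≤ _
    positivity
  · rw [lintegral_resolvent hp hμ]
    exact ENNReal.ofReal_ne_top

lemma integral_resolvent {p μ : ℝ} (hp : 1 < p) (hμ : 0 < μ) :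
    ∫ x in Set.Ioi (0 : ℝ), (x ^ p + μ)⁻¹ =
      μ ^ (1 / p - 1) * (1 / p * (π / Real.sin (π * (1 / p)))) := by
  have hsin := sin_pi_div_pos hp
  rw [integral_eq_lintegral_of_nonneg_ae, lintegral_resolvent hp hμ, ENNReal.toReal_ofReal]
  · positivity
  · refine (ae_restrict_iff' measurableSet_Ioi).2 (ae_of_all _ fun t ht => ?_)
    have ht0 : (0 : ℝ) < t := ht
    change 0 ≤ _
    positivity
  · exact (integrableOn_resolvent hp hμ).aestronglyMeasurable

/-! ### Comparison of the resolvent sum with the integral -/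

/-- A chord bound for `x ↦ (x ^ p + μ)⁻¹` on an interval of length one. -/
lemma resolvent_chord_le {p μ r a x : ℝ} (hp : 1 < p) (hμ : 0 < μ) (ha : 0 ≤ a)
    (hr : r * ((a + 1) ^ p + μ) ≤ a ^ p + μ) (hax : a ≤ x) (hxa : x ≤ a + 1) :
    ((a + 1) ^ p + μ)⁻¹ + (a + 1 - x) * (r * ((a ^ p + μ)⁻¹ - ((a + 1) ^ p + μ)⁻¹)) ≤
      (x ^ p + μ)⁻¹ := by
  have hx : 0 ≤ x := ha.trans hax
  have hA : 0 < a ^ p + μ := by positivity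
  have hB : 0 < (a + 1) ^ p + μ := by positivity
  have hX : 0 < x ^ p + μ := by positivity
  have hAB : a ^ p ≤ (a + 1) ^ p := Real.rpow_le_rpow ha (by linarith) (by linarith)
  have hXB : x ^ p ≤ (a + 1) ^ p := Real.rpow_le_rpow hx hxa (by linarith)
  have hconv : x ^ p ≤ (a + 1 - x) * a ^ p + (x - a) * (a + 1) ^ p := by
    have := (convexOn_rpow hp.le).2 (show a ∈ Set.Ici (0 : ℝ) from ha)
      (show a + 1 ∈ Set.Ici (0 : ℝ) by simp; linarith)
      (show 0 ≤ a + 1 - x by linarith) (show 0 ≤ x - a by linarith) (by ring)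
    simp only [smul_eq_mul] at this
    rwa [show (a + 1 - x) * a + (x - a) * (a + 1) = x by ring] at this
  set A := a ^ p + μ with hA'
  set B := (a + 1) ^ p + μ with hB'
  set X := x ^ p + μ with hX'
  have ht : 0 ≤ a + 1 - x := by linarith
  have hBX : (a + 1 - x) * (B - A) ≤ B - X := by
    rw [hA', hB', hX']; nlinarith
  have hBA : 0 ≤ B - A := by rw [hA', hB']; linarith
  have hXB' : X ≤ B := by rw [hX', hB']; linarith
  -- The reciprocal of a convex function need not lie above its chord; `r B ≤ A` flattens the slope
  -- enough that it does.
  have h1 : r * (A⁻¹ - B⁻¹) ≤ (B - A) / (B * B) := by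
    have : r * (A⁻¹ - B⁻¹) = (r * B) * (B - A) / (A * B * B) := by field_simp
    rw [this, show (B - A) / (B * B) = A * (B - A) / (A * B * B) by field_simp]
    gcongr
  have h2 : (a + 1 - x) * ((B - A) / (B * B)) ≤ X⁻¹ - B⁻¹ := by
    have : X⁻¹ - B⁻¹ = (B - X) / (X * B) := by field_simp
    rw [this, ← mul_div_assoc]
    have h3 : 0 ≤ B - X := by linarith
    calc (a + 1 - x) * (B - A) / (B * B) ≤ (B - X) / (B * B) := by gcongr
      _ ≤ (B - X) / (X * B) := by gcongr
  linarith [mul_le_mul_of_nonneg_left h1 ht]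

/-- Integrating the flattened chord over `[n, n+1]` gives the right endpoint value plus `r/2` times
the drop of the integrand; the drops telescope to the value `μ⁻¹` at `0`. -/
lemma resolvent_sum_add_le_integral {l μ r : ℝ} (hl : 1 / 2 < l) (hμ : 0 < μ)
    (hr : ∀ n : ℕ, r * (((n : ℝ) + 1) ^ (2 * l) + μ) ≤ (n : ℝ) ^ (2 * l) + μ) :
    resolventSum l μ + r / 2 * μ⁻¹ ≤ ∫ x in Set.Ioi (0 : ℝ), (x ^ (2 * l) + μ)⁻¹ := by
  have hp : 1 < 2 * l := by linarith
  set h : ℝ → ℝ := fun x => (x ^ (2 * l) + μ)⁻¹ with hh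
  have hii : ∀ n : ℕ, IntervalIntegrable h volume n ((n + 1 : ℕ) : ℝ) := fun n => by
    refine ((continuousOn_resolvent hp hμ).mono fun x hx => ?_).intervalIntegrable
    rw [Set.uIcc_of_le (by push_cast; linarith)] at hx
    exact (Nat.cast_nonneg n).trans hx.1
  have hstep : ∀ n : ℕ, h (n + 1) + r / 2 * (h n - h (n + 1)) ≤
      ∫ x in (n : ℝ)..((n + 1 : ℕ) : ℝ), h x := by
    intro n
    have haff : ∫ x in (n : ℝ)..((n + 1 : ℕ) : ℝ),
        (h (n + 1) + ((n : ℝ) + 1 - x) * (r * (h n - h (n + 1)))) =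
        h (n + 1) + r / 2 * (h n - h (n + 1)) := by
      rw [intervalIntegral.integral_add (Continuous.intervalIntegrable (by fun_prop) _ _)
        (Continuous.intervalIntegrable (by fun_prop) _ _),
        intervalIntegral.integral_mul_const, intervalIntegral.integral_sub (Continuous.intervalIntegrable (by fun_prop) _ _)
        (Continuous.intervalIntegrable (by fun_prop) _ _)]
      simp
      ring
    rw [← haff]
    refine intervalIntegral.integral_mono_on (by push_cast; linarith)
      (Continuous.intervalIntegrable (by fun_prop) _ _) (hii n) fun x hx => ?_
    exact resolvent_chord_le hp hμ (Nat.cast_nonneg n) (hr n) hx.1 (by simpa using hx.2)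
  have hsum : ∀ N : ℕ, ∑ n ∈ Finset.range N, h (n + 1) + r / 2 * (h 0 - h N) ≤
      ∫ x in Set.Ioi (0 : ℝ), h x := by
    intro N
    have h1 : ∑ n ∈ Finset.range N, (h (n + 1) + r / 2 * (h n - h (n + 1))) =
        ∑ n ∈ Finset.range N, h (n + 1) + r / 2 * (h 0 - h N) := by
      rw [Finset.sum_add_distrib, ← Finset.mul_sum]
      have := Finset.sum_range_sub' (fun n : ℕ => h n) N
      push_cast at this
      rw [this]
    rw [← h1]
    refine (Finset.sum_le_sum fun n _ => hstep n).trans ?_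
    rw [intervalIntegral.sum_integral_adjacent_intervals (a := fun n : ℕ => (n : ℝ))
      (fun n _ => hii n), Nat.cast_zero, intervalIntegral.integral_of_le (Nat.cast_nonneg N)]
    refine setIntegral_mono_set (integrableOn_resolvent hp hμ) ?_
      Set.Ioc_subset_Ioi_self.eventuallyLE
    refine (ae_restrict_iff' measurableSet_Ioi).2 (ae_of_all _ fun t ht => ?_)
    have ht0 : (0 : ℝ) < t := ht
    change 0 ≤ (t ^ (2 * l) + μ)⁻¹
    positivity
  have hlim : Filter.Tendsto (fun N : ℕ => h N) Filter.atTop (nhds 0) := by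
    refine Filter.Tendsto.inv_tendsto_atTop ?_
    exact Filter.tendsto_atTop_add_const_right _ _
      ((tendsto_rpow_atTop (by linarith)).comp tendsto_natCast_atTop_atTop)
  have h0 : h 0 = μ⁻¹ := by
    simp only [hh]
    rw [Real.zero_rpow (by linarith), zero_add]
  have := (summable_resolvent hl hμ.le).hasSum.tendsto_sum_nat.add
    (((tendsto_const_nhds (x := h 0)).sub hlim).const_mul (r / 2))
  rw [sub_zero, h0] at this
  refine le_of_tendsto' this fun N => ?_
  have := hsum N
  rwa [h0] at this

/-- With `α = 1/(2l)` one has `1 - α = α(2l - 1)`, so the powers of `α` combine and cancel `2l`.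
This is the form that the optimised integral bound takes. -/
lemma c_eq {l : ℝ} (hl : 1 / 2 < l) :
    c l = (2 * l - 1) ^ (1 / (2 * l) - 1) / Real.sin (π * (1 / (2 * l))) := by
  have hl0 : 0 < l := by linarith
  have hsin := sin_pi_div_pos (p := 2 * l) (by linarith)
  have hm : 0 < 2 * l - 1 := by linarith
  have h1 : 1 - 1 / (2 * l) = (1 / (2 * l)) * (2 * l - 1) := by field_simp
  have hα : 0 < 1 / (2 * l) := by positivity
  have h2 : (1 / (2 * l)) ^ (1 / (2 * l)) * (1 - 1 / (2 * l)) ^ (1 - 1 / (2 * l)) =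
      1 / (2 * l) * (2 * l - 1) ^ (1 - 1 / (2 * l)) := by
    rw [show (1 - 1 / (2 * l)) ^ (1 - 1 / (2 * l)) =
      (1 / (2 * l) * (2 * l - 1)) ^ (1 - 1 / (2 * l)) by rw [← h1], Real.mul_rpow hα.le hm.le, ← mul_assoc, ← Real.rpow_add hα]
    norm_num
  rw [c, mul_assoc (2 * l), h2, show 1 / (2 * l) - 1 = -(1 - 1 / (2 * l)) by ring,
    Real.rpow_neg hm.le]
  field_simp

lemma c_pos {l : ℝ} (hl : 1 / 2 < l) : 0 < c l := by
  have hsin := sin_pi_div_pos (p := 2 * l) (by linarith)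
  have hm : 0 < 2 * l - 1 := by linarith
  rw [c_eq hl]
  positivity

lemma exists_pos_correctedIneq {l : ℝ} (hl : 1 / 2 < l) : ∃ κ, 0 < κ ∧ CorrectedIneq l κ := by
  have hl0 : 0 < l := by linarith
  have hm : 0 < 2 * l - 1 := by linarith
  have hsin := sin_pi_div_pos (p := 2 * l) (by linarith)
  -- The two conditions serve the chord bound on `[n, n+1]`: the first for `n ≥ 1`, where `n + 1 ≤
  -- 2n`, the second for `n = 0`, where `μ ≥ 2l - 1`.
  obtain ⟨r, hr0, hr1, hr2⟩ : ∃ r : ℝ, 0 < r ∧ r * 2 ^ (2 * l) ≤ 1 ∧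
      r * (1 + (2 * l - 1)) ≤ 2 * l - 1 := by
    refine ⟨min ((2 ^ (2 * l))⁻¹) ((2 * l - 1) / (1 + (2 * l - 1))), by positivity, ?_, ?_⟩
    · rw [← le_div_iff₀ (by positivity), one_div]
      exact min_le_left _ _
    · rw [← le_div_iff₀ (by positivity)]
      exact min_le_right _ _
  have hr3 : r ≤ 1 := by nlinarith
  refine ⟨r / (2 * π), by positivity, correctedIneq_of_resolventSum hl fun s hs => ?_⟩
  have hs0 : 0 < s := by linarith
  have hs2 : 1 ≤ s ^ 2 := one_le_pow₀ hs
  have hμ : 0 < (2 * l - 1) * s ^ 2 := by positivity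
  -- This `μ` minimises `μ^{1/(2l) - 1} (s² + μ)`, the bound coming from the integral.
  refine ⟨(2 * l - 1) * s ^ 2, hμ, ?_⟩
  set μ := (2 * l - 1) * s ^ 2 with hμdef
  have hμm : 2 * l - 1 ≤ μ := by rw [hμdef]; nlinarith
  have hle := resolvent_sum_add_le_integral (r := r) hl hμ fun n => by
    rcases Nat.eq_zero_or_pos n with rfl | hn
    · rw [Nat.cast_zero, zero_add, Real.one_rpow, Real.zero_rpow (by linarith)]
      nlinarith
    · have hn1 : (1 : ℝ) ≤ n := by exact_mod_cast hn
      have h1 : ((n : ℝ) + 1) ^ (2 * l) ≤ 2 ^ (2 * l) * (n : ℝ) ^ (2 * l) := by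
        rw [← Real.mul_rpow (by norm_num) (by positivity)]
        exact Real.rpow_le_rpow (by positivity) (by linarith) (by linarith)
      have h2 : (0 : ℝ) ≤ (n : ℝ) ^ (2 * l) := by positivity
      calc r * (((n : ℝ) + 1) ^ (2 * l) + μ)
          ≤ r * (2 ^ (2 * l) * (n : ℝ) ^ (2 * l) + μ) := by gcongr
        _ = r * 2 ^ (2 * l) * (n : ℝ) ^ (2 * l) + r * μ := by ring
        _ ≤ 1 * (n : ℝ) ^ (2 * l) + 1 * μ := by gcongr
        _ = _ := by ring
  rw [integral_resolvent (by linarith) hμ] at hle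
  have hsμ : s ^ 2 + μ = 2 * l * s ^ 2 := by rw [hμdef]; ring
  have hpow : μ ^ (1 / (2 * l) - 1) * s ^ 2 = (2 * l - 1) ^ (1 / (2 * l) - 1) * s ^ (1 / l) := by
    rw [hμdef, Real.mul_rpow hm.le (by positivity), mul_assoc]
    congr 1
    rw [← Real.rpow_two, ← Real.rpow_mul hs0.le, ← Real.rpow_add hs0]
    congr 1
    field_simp
    ring
  have hc : μ ^ (1 / (2 * l) - 1) * (1 / (2 * l) * (π / Real.sin (π * (1 / (2 * l))))) / π *
      (s ^ 2 + μ) = c l * s ^ (1 / l) := by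
    calc _ = (μ ^ (1 / (2 * l) - 1) * s ^ 2) / Real.sin (π * (1 / (2 * l))) := by
          rw [hsμ]; field_simp
      _ = _ := by rw [hpow, c_eq hl]; ring
  have hκ : r / (2 * π) ≤ r / 2 * μ⁻¹ / π * (s ^ 2 + μ) := by
    have : r / 2 * μ⁻¹ / π * (s ^ 2 + μ) = r / (2 * π) * (1 + s ^ 2 / μ) := by field_simp; ring
    rw [this]
    have : 0 ≤ s ^ 2 / μ := by positivity
    exact le_mul_of_one_le_right (by positivity) (by linarith)
  have hle2 := mul_le_mul_of_nonneg_right (div_le_div_of_nonneg_right hle Real.pi_pos.le)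
    (show 0 ≤ s ^ 2 + μ by positivity)
  rw [hc, add_div, add_mul] at hle2
  linarith

/-! ### First order derivatives -/

/-- The partial fraction series of `π cot(πz)` at `z = ia`. -/
lemma resolventSum_one {a : ℝ} (ha : 0 < a) :
    resolventSum 1 (a ^ 2) =
      π / (2 * a) * (1 + 2 / (Real.exp (2 * (π * a)) - 1)) - 1 / (2 * a ^ 2) := by
  have hz : Complex.I * a ∈ Complex.integerComplement := by
    rintro ⟨n, hn⟩
    have := congrArg Complex.im hn
    simp at this
    exact ha.ne this
  have hcot := cot_series_rep' hz
  have hE : 1 < Real.exp (2 * (π * a)) := Real.one_lt_exp_iff.2 (by positivity)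
  have hexp : Complex.exp (2 * π * Complex.I * (Complex.I * a)) =
      ((Real.exp (2 * (π * a)) : ℝ) : ℂ)⁻¹ := by
    rw [Complex.ofReal_exp, ← Complex.exp_neg]
    congr 1
    push_cast
    linear_combination 2 * (π : ℂ) * a * Complex.I_sq
  have hterm : ∀ n : ℕ, (1 / (Complex.I * a - (n + 1)) + 1 / (Complex.I * a + (n + 1)) : ℂ) =
      (-2 * Complex.I * a) * ((((((n : ℝ) + 1) ^ (2 * (1 : ℝ)) + a ^ 2)⁻¹ : ℝ)) : ℂ) := by
    intro n
    have h1 : Complex.I * a - (n + 1) ≠ 0 := by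
      intro h0
      have := congrArg Complex.im h0
      simp at this
      exact ha.ne' this
    have h2 : Complex.I * a + (n + 1) ≠ 0 := by
      intro h0
      have := congrArg Complex.im h0
      simp at this
      exact ha.ne' this
    have h3 : (((n : ℂ) + 1) ^ 2 + a ^ 2) ≠ 0 := by
      have : 0 < ((n : ℝ) + 1) ^ 2 + a ^ 2 := by positivity
      exact_mod_cast this.ne'
    rw [mul_one, Real.rpow_two]
    push_cast
    rw [div_add_div _ _ h1 h2, ← div_eq_mul_inv, div_eq_div_iff (mul_ne_zero h1 h2) h3]
    linear_combination 2 * Complex.I * (a : ℂ) ^ 3 * Complex.I_sq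
  have hsum : ∑' n : ℕ, (1 / (Complex.I * a - (n + 1)) + 1 / (Complex.I * a + (n + 1)) : ℂ) =
      (-2 * Complex.I * a) * ((resolventSum 1 (a ^ 2) : ℝ) : ℂ) := by
    rw [tsum_congr hterm, tsum_mul_left, resolventSum, Complex.ofReal_tsum]
  rw [hsum, Complex.cot_pi_eq_exp_ratio, hexp] at hcot
  set E := Real.exp (2 * (π * a)) with hEdef
  have hE0 : ((E : ℝ) : ℂ) ≠ 0 := by exact_mod_cast (by linarith : E ≠ 0)
  have hE1 : ((E : ℝ) : ℂ) - 1 ≠ 0 := by exact_mod_cast (by linarith : E - 1 ≠ 0)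
  have ha0 : (a : ℂ) ≠ 0 := by exact_mod_cast ha.ne'
  have hI := Complex.I_ne_zero
  have hE2 : (1 : ℂ) - ((E : ℝ) : ℂ)⁻¹ ≠ 0 := by
    rw [show (1 : ℂ) - ((E : ℝ) : ℂ)⁻¹ = (E - 1) / E by field_simp]
    exact div_ne_zero hE1 hE0
  refine Complex.ofReal_injective ?_
  push_cast
  have hq : (((E : ℝ) : ℂ)⁻¹ + 1) / (Complex.I * (1 - ((E : ℝ) : ℂ)⁻¹)) =
      -Complex.I * (1 + 2 / (E - 1)) := by
    rw [div_eq_iff (mul_ne_zero hI hE2)]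
    field_simp
    linear_combination (1 + (E : ℂ)) * Complex.I_sq
  rw [hq] at hcot
  have h5 : (1 : ℂ) / (Complex.I * a) = -Complex.I / a := by
    field_simp
    linear_combination Complex.I_sq
  rw [h5] at hcot
  have h6 : ((resolventSum 1 (a ^ 2) : ℝ) : ℂ) =
      (-2 * Complex.I * a * ((resolventSum 1 (a ^ 2) : ℝ) : ℂ)) / (-2 * Complex.I * a) := by
    field_simp
  rw [h6, ← hcot]
  field_simp
  ring

lemma c_one : c 1 = 1 := by
  rw [c_eq (by norm_num)]
  norm_num [show π * (1 / 2) = π / 2 by ring]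

/-- The cubic Taylor polynomial suffices. This controls the exponentially small term of
`resolventSum_one` in `correctedIneq_one`. -/
lemma exp_lower_bound {u : ℝ} (hu : 1 ≤ u) :
    2 * u * (2 * u ^ 2 + 2 * u + 1) ≤ (u + 1) * (Real.exp (2 * u) - 1) := by
  have h := Real.sum_le_exp_of_nonneg (show 0 ≤ 2 * u by linarith) 4
  simp only [Finset.sum_range_succ, Finset.sum_range_zero, Nat.factorial] at h
  norm_num at h
  have h2 : 2 * u + 2 * u ^ 2 + 4 / 3 * u ^ 3 ≤ Real.exp (2 * u) - 1 := by nlinarith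
  refine le_trans ?_ (mul_le_mul_of_nonneg_left h2 (by linarith))
  have h3 : u ^ 3 ≤ u ^ 4 := pow_le_pow_right₀ hu (by norm_num)
  have h4 : 0 ≤ u ^ 3 := by positivity
  nlinarith

lemma correctedIneq_one : CorrectedIneq 1 (1 / π) := by
  have hπ := Real.pi_pos
  refine correctedIneq_of_resolventSum (by norm_num) fun s hs => ?_
  -- The choice is `√μ = s - 1/π = u/π`. Without the exponential term the bound is `(2u³ - u -
  -- 1)/(2πu²)`, against a target of `u/π`; the slack `u + 1` absorbs that term.
  have hu : 1 ≤ π * s - 1 := by nlinarith [Real.pi_gt_three]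
  obtain ⟨u, hus⟩ : ∃ u, u = π * s - 1 := ⟨_, rfl⟩
  rw [← hus] at hu
  have hu0 : 0 < u := by linarith
  have hs' : s = (u + 1) / π := by rw [hus]; field_simp; ring
  refine ⟨(u / π) ^ 2, by positivity, ?_⟩
  rw [resolventSum_one (by positivity), c_one, div_one, Real.rpow_one, one_mul,
    show π * (u / π) = u by field_simp, hs']
  have hE := exp_lower_bound hu
  have hE1 : 0 < Real.exp (2 * u) - 1 := by
    have := Real.one_lt_exp_iff.2 (show 0 < 2 * u by linarith)
    linarith
  set D := Real.exp (2 * u) - 1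
  have h1 : 2 * u * (2 * u ^ 2 + 2 * u + 1) / D ≤ u + 1 := by
    rwa [div_le_iff₀ hE1]
  have h2 : (π / (2 * (u / π)) * (1 + 2 / D) - 1 / (2 * (u / π) ^ 2)) / π *
      (((u + 1) / π) ^ 2 + (u / π) ^ 2) =
      ((2 * u ^ 2 + 2 * u + 1) * (u - 1) + 2 * u * (2 * u ^ 2 + 2 * u + 1) / D) /
        (2 * u ^ 2 * π) := by
    field_simp
    ring
  rw [h2, div_le_iff₀ (by positivity)]
  have h3 : ((u + 1) / π - 1 / π) * (2 * u ^ 2 * π) = 2 * u ^ 3 := by field_simp; ring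
  rw [h3]
  linarith

/-! ### Test functions -/

/-- Conjugation commutes with the principal power off the negative real axis, and `ik` is imaginary.
Hence real functions have real derivatives of order `l`. -/
lemma conj_I_mul_int_cpow (l : ℝ) (hl : 0 < l) (k : ℤ) :
    (starRingEnd ℂ) ((Complex.I * (k : ℂ)) ^ (l : ℂ)) =
      (Complex.I * ((-k : ℤ) : ℂ)) ^ (l : ℂ) := by
  rcases eq_or_ne k 0 with rfl | hk
  · have : (l : ℂ) ≠ 0 := by exact_mod_cast hl.ne'
    simp [Complex.zero_cpow this]
  · have harg : (Complex.I * (k : ℂ)).arg ≠ π := by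
      rw [Ne, Complex.arg_eq_pi_iff]
      simp
    have := Complex.conj_cpow (Complex.I * (k : ℂ)) l harg
    rw [Complex.conj_ofReal] at this
    rw [← this]
    congr 1
    simp

/-- Even real coefficients give a cosine polynomial; its continuous representative allows evaluation
at `0`, where it equals the sum of its coefficients. -/
lemma exists_test_function {l : ℝ} (hl : 0 < l) (s : Finset ℤ) (hs : ∀ k ∈ s, -k ∈ s)
    (b : ℤ → ℝ) (hb : ∀ k, b (-k) = b k) (hb0 : b 0 = 0) :
    ∃ f g : L2Circ, InSobolev l f g ∧ ‖f‖ ^ 2 = 2 * π * ∑ k ∈ s, b k ^ 2 ∧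
      ‖g‖ ^ 2 = 2 * π * ∑ k ∈ s, |(k : ℝ)| ^ (2 * l) * b k ^ 2 ∧
      ∃ F : C(Circ, ℝ), f =ᵐ[volume] F ∧ F 0 = ∑ k ∈ s, b k := by
  obtain ⟨f, hf, F, hfF, hF⟩ := exists_trigPoly s hs (fun k => (b k : ℂ))
    (fun k _ => by simp [hb])
  obtain ⟨g, hg, -⟩ := exists_trigPoly s hs
    (fun k => (Complex.I * (k : ℂ)) ^ (l : ℂ) * (b k : ℂ))
    (fun k _ => by rw [map_mul, conj_I_mul_int_cpow l hl, hb, Complex.conj_ofReal])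
  have hsob : InSobolev l f g := by
    refine ⟨?_, fun k => ?_⟩
    · rw [meanZero_iff, hf]
      simp [hb0]
    · change coef g k = _ * coef f k
      rw [hf, hg]
      split_ifs <;> simp
  have hnorm : ∀ h : L2Circ, (∀ k ∉ s, coef h k = 0) →
      ‖h‖ ^ 2 = 2 * π * ∑ k ∈ s, ‖coef h k‖ ^ 2 := by
    intro h hh
    have h1 := (hasSum_sq_coef h).unique
      (hasSum_sum_of_ne_finset_zero fun k hk => by rw [hh k hk]; simp)
    rw [← h1]
    field_simp
  refine ⟨f, g, hsob, ?_, ?_, F, hfF, ?_⟩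
  · rw [hnorm f fun k hk => by rw [hf, if_neg hk]]
    congr 1
    refine Finset.sum_congr rfl fun k hk => ?_
    rw [hf, if_pos hk]
    simp
  · rw [hnorm g fun k hk => by rw [hg, if_neg hk]]
    congr 1
    refine Finset.sum_congr rfl fun k hk => ?_
    rw [hsob.norm_coef_sq, hf, if_pos hk]
    simp
  · rw [hF]
    simp

lemma le_of_ae_le_continuous {F : C(Circ, ℝ)} {C : ℝ} (h : ∀ᵐ x : Circ, F x ≤ C) (x : Circ) :
    F x ≤ C := by
  have hd : Dense {x : Circ | F x ≤ C} := Measure.dense_of_ae h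
  have hc : IsClosed {x : Circ | F x ≤ C} := isClosed_le (by fun_prop) continuous_const
  have := hc.closure_eq ▸ hd x
  exact this

lemma bddAbove_correctedIneq {l : ℝ} (hl : 1 / 2 < l) : BddAbove {κ | CorrectedIneq l κ} := by
  -- The test function is `2 cos x`; any nonzero one would bound `κ`.
  obtain ⟨f, g, hfg, hf, -⟩ := exists_test_function (show 0 < l by linarith)
    (Finset.Icc (-1) 1) (fun k hk => by simp at hk ⊢; omega)
    (fun k => if k = 0 then 0 else 1) (by simp) (by simp)
  have hf0 : 0 < ‖f‖ ^ 2 := by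
    rw [hf]
    refine mul_pos (by positivity) (Finset.sum_pos' (fun k _ => by positivity) ⟨1, by simp⟩)
  refine ⟨c l * ‖f‖ ^ (2 - 1 / l) * ‖g‖ ^ (1 / l) / ‖f‖ ^ 2, fun κ hκ => ?_⟩
  obtain ⟨x, hx⟩ := (hκ f g hfg).exists
  rw [le_div_iff₀ hf0]
  nlinarith [sq_nonneg (f x)]

/-- The supremum is attained: admissible constants converge to it along a sequence, and countably
many null sets can be discarded together. -/
lemma correctedIneq_K {l : ℝ} (hl : 1 / 2 < l) : CorrectedIneq l (K l) := by
  intro f g hfg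
  obtain ⟨κ₀, -, hκ₀⟩ := exists_pos_correctedIneq hl
  obtain ⟨u, -, hu, hmem⟩ := exists_seq_tendsto_sSup ⟨κ₀, hκ₀⟩ (bddAbove_correctedIneq hl)
  have h : ∀ᵐ x : Circ, ∀ n, (f x) ^ 2 ≤
      c l * ‖f‖ ^ (2 - 1 / l) * ‖g‖ ^ (1 / l) - u n * ‖f‖ ^ 2 :=
    ae_all_iff.2 fun n => hmem n f g hfg
  filter_upwards [h] with x hx
  exact ge_of_tendsto' ((hu.mul_const _).const_sub _) hx

lemma K_pos {l : ℝ} (hl : 1 / 2 < l) : 0 < K l := by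
  obtain ⟨κ, hκ, h⟩ := exists_pos_correctedIneq hl
  exact hκ.trans_le (le_csSup (bddAbove_correctedIneq hl) h)

/-! ### The sharp correction constant for first order derivatives -/

lemma tendsto_Icc_neg_atTop :
    Filter.Tendsto (fun n : ℕ => Finset.Icc (-(n : ℤ)) n) Filter.atTop Filter.atTop := by
  refine Filter.tendsto_atTop_finset_of_monotone (fun m n hmn => ?_) fun k => ⟨k.natAbs, ?_⟩
  · exact Finset.Icc_subset_Icc (by simpa using hmn) (by simpa using hmn)
  · rw [Finset.mem_Icc]
    omega

/-- The coefficients `(k² + a²)⁻¹`, `k ≠ 0`, of a near extremal function. -/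
def greenCoef (a : ℝ) (k : ℤ) : ℝ := if k = 0 then 0 else (|(k : ℝ)| ^ (2 * (1 : ℝ)) + a ^ 2)⁻¹

lemma greenCoef_neg (a : ℝ) (k : ℤ) : greenCoef a (-k) = greenCoef a k := by
  simp [greenCoef]

lemma tendsto_sum_greenCoef (a : ℝ) :
    Filter.Tendsto (fun n : ℕ => ∑ k ∈ Finset.Icc (-(n : ℤ)) n, greenCoef a k) Filter.atTop
      (nhds (2 * resolventSum 1 (a ^ 2))) :=
  (hasSum_int_resolvent (l := 1) (by norm_num) (sq_nonneg a)).comp tendsto_Icc_neg_atTop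

/-- Since `greenCoef a k ^ 2` is minus the derivative of the coefficient in `a²`, this difference
quotient replaces a sum of squares by known sums. -/
lemma greenCoef_sub_le {a b : ℝ} (ha : 0 < a) (hab : a < b) (k : ℤ) :
    greenCoef a k - greenCoef b k ≤ (b ^ 2 - a ^ 2) * greenCoef a k ^ 2 := by
  unfold greenCoef
  split_ifs with hk
  · simp
  · have hw : 0 ≤ |(k : ℝ)| ^ (2 * (1 : ℝ)) := by positivity
    set w := |(k : ℝ)| ^ (2 * (1 : ℝ))
    have hb : 0 < b := ha.trans hab
    have hsq : a ^ 2 < b ^ 2 := by gcongr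
    have hA : 0 < w + a ^ 2 := by positivity
    have hB : 0 < w + b ^ 2 := by positivity
    have h1 : (w + a ^ 2)⁻¹ - (w + b ^ 2)⁻¹ =
        (b ^ 2 - a ^ 2) * ((w + a ^ 2)⁻¹ * (w + b ^ 2)⁻¹) := by field_simp; ring
    rw [h1, sq (w + a ^ 2)⁻¹]
    have h2 : (w + b ^ 2)⁻¹ ≤ (w + a ^ 2)⁻¹ := inv_anti₀ hA (by linarith)
    have h3 : 0 ≤ (w + a ^ 2)⁻¹ := by positivity
    exact mul_le_mul_of_nonneg_left (mul_le_mul_of_nonneg_left h2 h3) (by linarith)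

lemma CorrectedIneq.sum_greenCoef_le {κ : ℝ} (h : CorrectedIneq 1 κ) {a : ℝ} (ha : 0 < a) (n : ℕ) :
    (∑ k ∈ Finset.Icc (-(n : ℤ)) n, greenCoef a k) ^ 2 ≤
      π / a * (∑ k ∈ Finset.Icc (-(n : ℤ)) n, greenCoef a k) -
        κ * (2 * π * ∑ k ∈ Finset.Icc (-(n : ℤ)) n, greenCoef a k ^ 2) := by
  obtain ⟨f, g, hfg, hf, hg, F, hfF, hF⟩ := exists_test_function one_pos
    (Finset.Icc (-(n : ℤ)) n) (fun k hk => by simp at hk ⊢; omega) (greenCoef a)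
    (greenCoef_neg a) (by simp [greenCoef])
  have h1 : ∀ᵐ x : Circ, (F ^ 2) x ≤ ‖f‖ * ‖g‖ - κ * ‖f‖ ^ 2 := by
    filter_upwards [h f g hfg, hfF] with x hx hx'
    rw [hx', c_one] at hx
    norm_num at hx
    simpa using hx
  have h2 := le_of_ae_le_continuous h1 0
  rw [ContinuousMap.pow_apply, hF, hf] at h2
  have h3 : ‖g‖ ^ 2 + a ^ 2 * ‖f‖ ^ 2 =
      2 * π * ∑ k ∈ Finset.Icc (-(n : ℤ)) n, greenCoef a k := by
    rw [hf, hg, mul_left_comm, ← mul_add, Finset.mul_sum, ← Finset.sum_add_distrib]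
    congr 1
    refine Finset.sum_congr rfl fun k _ => ?_
    rw [← add_mul]
    unfold greenCoef
    split_ifs
    · simp
    · have : |(k : ℝ)| ^ (2 * (1 : ℝ)) + a ^ 2 ≠ 0 := by positivity
      field_simp
  -- `2a‖f‖‖g‖ ≤ ‖g‖² + a²‖f‖²`, and the right side collapses because the coefficients invert the
  -- weights `k² + a²`.
  have h4 : ‖f‖ * ‖g‖ ≤ π / a * ∑ k ∈ Finset.Icc (-(n : ℤ)) n, greenCoef a k := by
    rw [div_mul_eq_mul_div, le_div_iff₀ ha]
    nlinarith [sq_nonneg (‖g‖ - a * ‖f‖)]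
  linarith

lemma CorrectedIneq.resolventSum_le {κ : ℝ} (h : CorrectedIneq 1 κ) (hκ : 0 ≤ κ) {a b : ℝ}
    (ha : 0 < a) (hab : a < b) :
    κ * (2 * π) * (2 * resolventSum 1 (a ^ 2) - 2 * resolventSum 1 (b ^ 2)) ≤
      (b ^ 2 - a ^ 2) * (π / a * (2 * resolventSum 1 (a ^ 2)) -
        (2 * resolventSum 1 (a ^ 2)) ^ 2) := by
  have hA := tendsto_sum_greenCoef a
  have hB := tendsto_sum_greenCoef b
  have hsq : 0 < b ^ 2 - a ^ 2 := by nlinarith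
  refine le_of_tendsto_of_tendsto' ((hA.sub hB).const_mul (κ * (2 * π)))
    (((hA.const_mul (π / a)).sub (hA.pow 2)).const_mul (b ^ 2 - a ^ 2)) fun n => ?_
  have h1 := h.sum_greenCoef_le ha n
  have h2 : ∑ k ∈ Finset.Icc (-(n : ℤ)) n, greenCoef a k -
      ∑ k ∈ Finset.Icc (-(n : ℤ)) n, greenCoef b k ≤
      (b ^ 2 - a ^ 2) * ∑ k ∈ Finset.Icc (-(n : ℤ)) n, greenCoef a k ^ 2 := by
    rw [← Finset.sum_sub_distrib, Finset.mul_sum]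
    exact Finset.sum_le_sum fun k _ => greenCoef_sub_le ha hab k
  have h3 := mul_le_mul_of_nonneg_left h2 (show 0 ≤ κ * (2 * π) by positivity)
  have h4 := mul_le_mul_of_nonneg_left h1 hsq.le
  linarith

/-- Here `t = 1/a` and `b = a + 1`: a unit step is relatively small as `a → ∞`, so no
differentiation is needed. At `t = 0` the bound reads `2κπ ≤ 2`. -/
lemma CorrectedIneq.le_of_pos {κ : ℝ} (h : CorrectedIneq 1 κ) (hκ : 0 ≤ κ) {t : ℝ} (ht : 0 < t) :
    2 * κ * (π * (1 + t) - t * (2 + t)) ≤ (2 + t) * (1 + t) ^ 2 := by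
  have hπ := Real.pi_pos
  obtain ⟨a, ha, rfl⟩ : ∃ a : ℝ, 0 < a ∧ t = 1 / a := ⟨1 / t, by positivity, by simp⟩
  have hb : 0 < a + 1 := by linarith
  have h1 := h.resolventSum_le hκ ha (lt_add_one a)
  rw [resolventSum_one ha, resolventSum_one hb] at h1
  have hEa : 2 * (π * a) ≤ Real.exp (2 * (π * a)) - 1 := by
    linarith [Real.add_one_le_exp (2 * (π * a))]
  have hEb : Real.exp (2 * (π * a)) ≤ Real.exp (2 * (π * (a + 1))) :=
    Real.exp_le_exp.2 (by nlinarith)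
  have hpa : 0 < 2 * (π * a) := by positivity
  obtain ⟨ε, hε⟩ : ∃ ε, ε = 2 / (Real.exp (2 * (π * a)) - 1) := ⟨_, rfl⟩
  obtain ⟨δ, hδ⟩ : ∃ δ, δ = 2 / (Real.exp (2 * (π * (a + 1))) - 1) := ⟨_, rfl⟩
  have hε0 : 0 ≤ ε := by rw [hε]; exact div_nonneg two_pos.le (by linarith)
  have hε1 : ε ≤ 1 / (π * a) := by
    rw [hε]
    calc _ ≤ 2 / (2 * (π * a)) := by gcongr
      _ = _ := by field_simp
  have hδ0 : 0 ≤ δ := by rw [hδ]; exact div_nonneg two_pos.le (by linarith)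
  have hδε : δ ≤ ε := by
    rw [hε, hδ]
    exact div_le_div_of_nonneg_left two_pos.le (by linarith) (by linarith)
  rw [← hε, ← hδ] at h1
  -- Dropping the exponential terms only lowers the difference, as they decrease in `a`.
  have hdiff : π / (2 * a) * (1 + 0) - 1 / (2 * a ^ 2) -
      (π / (2 * (a + 1)) * (1 + 0) - 1 / (2 * (a + 1) ^ 2)) ≤
      π / (2 * a) * (1 + ε) - 1 / (2 * a ^ 2) -
      (π / (2 * (a + 1)) * (1 + δ) - 1 / (2 * (a + 1) ^ 2)) := by
    have : π / (2 * (a + 1)) * δ ≤ π / (2 * a) * ε := by gcongr; linarith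
    linarith
  have hR : π / (2 * a) * (1 + ε) - 1 / (2 * a ^ 2) ≤ π / (2 * a) := by
    have : π / (2 * a) * ε ≤ π / (2 * a) * (1 / (π * a)) := by gcongr
    have h2 : π / (2 * a) * (1 / (π * a)) = 1 / (2 * a ^ 2) := by field_simp
    linarith
  set R := π / (2 * a) * (1 + ε) - 1 / (2 * a ^ 2) with hRdef
  have hR0 : 0 ≤ R := by
    have := resolventSum_nonneg (l := 1) (sq_nonneg a)
    rwa [resolventSum_one ha, ← hε] at this
  have hR2 : π / a * (2 * R) - (2 * R) ^ 2 ≤ π / a ^ 3 := by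
    have h3 : π / a - 2 * R ≤ 1 / a ^ 2 := by
      have h4 : 2 * R = π / a * (1 + ε) - 1 / a ^ 2 := by rw [hRdef]; field_simp
      have h5 : 0 ≤ π / a * ε := by positivity
      linarith
    calc _ = 2 * R * (π / a - 2 * R) := by ring
      _ ≤ 2 * R * (1 / a ^ 2) := by gcongr
      _ ≤ 2 * (π / (2 * a)) * (1 / a ^ 2) := by gcongr
      _ = _ := by field_simp
  have h6 := mul_le_mul_of_nonneg_left hR2 (show 0 ≤ (a + 1) ^ 2 - a ^ 2 by nlinarith)
  have h7 := mul_le_mul_of_nonneg_left hdiff (show 0 ≤ κ * (2 * π) * 2 by positivity)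
  have h8 : κ * (2 * π) * 2 * (π / (2 * a) * (1 + 0) - 1 / (2 * a ^ 2) -
      (π / (2 * (a + 1)) * (1 + 0) - 1 / (2 * (a + 1) ^ 2))) ≤
      ((a + 1) ^ 2 - a ^ 2) * (π / a ^ 3) := by linarith
  have h9 := mul_le_mul_of_nonneg_right h8 (show 0 ≤ (a + 1) ^ 2 / π by positivity)
  have hl : κ * (2 * π) * 2 * (π / (2 * a) * (1 + 0) - 1 / (2 * a ^ 2) -
      (π / (2 * (a + 1)) * (1 + 0) - 1 / (2 * (a + 1) ^ 2))) * ((a + 1) ^ 2 / π) =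
      2 * κ * (π * (1 + 1 / a) - 1 / a * (2 + 1 / a)) := by
    field_simp
    ring
  have hr : ((a + 1) ^ 2 - a ^ 2) * (π / a ^ 3) * ((a + 1) ^ 2 / π) =
      (2 + 1 / a) * (1 + 1 / a) ^ 2 := by
    field_simp
    ring
  rwa [hl, hr] at h9

lemma CorrectedIneq.le_inv_pi {κ : ℝ} (h : CorrectedIneq 1 κ) : κ ≤ 1 / π := by
  have hπ := Real.pi_pos
  rcases le_total κ 0 with hκ | hκ
  · exact hκ.trans (by positivity)
  have hl : Filter.Tendsto (fun t : ℝ => 2 * κ * (π * (1 + t) - t * (2 + t)))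
      (nhdsWithin 0 (Set.Ioi 0)) (nhds (2 * κ * (π * (1 + 0) - 0 * (2 + 0)))) :=
    (Continuous.tendsto (by fun_prop) 0).mono_left nhdsWithin_le_nhds
  have hr : Filter.Tendsto (fun t : ℝ => (2 + t) * (1 + t) ^ 2)
      (nhdsWithin 0 (Set.Ioi 0)) (nhds ((2 + 0) * (1 + 0) ^ 2)) :=
    (Continuous.tendsto (by fun_prop) 0).mono_left nhdsWithin_le_nhds
  have := le_of_tendsto_of_tendsto hl hr
    (Filter.eventually_of_mem self_mem_nhdsWithin fun t ht => h.le_of_pos hκ ht)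
  rw [le_div_iff₀ hπ]
  linarith

lemma K_one : K 1 = 1 / π :=
  le_antisymm (csSup_le ⟨_, correctedIneq_one⟩ fun _ h => CorrectedIneq.le_inv_pi h)
    (le_csSup (bddAbove_correctedIneq (by norm_num)) correctedIneq_one)

/-! ### The inequality for orthonormal systems -/

lemma coeFn_sum_smul {ι : Type*} [Fintype ι] (ξ : ι → ℝ) (φ : ι → L2Circ) :
    (∑ j, ξ j • φ j : L2Circ) =ᵐ[volume] fun x => ∑ j, ξ j * φ j x := by
  have h1 := Lp.coeFn_finsetSum Finset.univ (fun j => ξ j • φ j)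
  have h2 : ∀ᵐ x : Circ, ∀ j, (ξ j • φ j : L2Circ) x = ξ j * φ j x :=
    ae_all_iff.2 fun j => by
      filter_upwards [Lp.coeFn_smul (ξ j) (φ j)] with x hx
      simpa using hx
  filter_upwards [h1, h2] with x hx hx2
  rw [hx, Finset.sum_apply]
  exact Finset.sum_congr rfl fun j _ => hx2 j

lemma norm_sum_smul_sq {ι : Type*} [Fintype ι] {φ : ι → L2Circ} (hφ : Orthonormal ℝ φ)
    (ξ : ι → ℝ) : ‖∑ j, ξ j • φ j‖ ^ 2 = ∑ j, ξ j ^ 2 := by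
  rw [← real_inner_self_eq_norm_sq, hφ.inner_sum]
  simp [sq]

/-- The corrected inequality for all linear combinations, outside of one null set. -/
lemma ae_forall_sum_le {l κ : ℝ} (hl : 1 / 2 < l) (hκ : CorrectedIneq l κ) {N : ℕ}
    {φ dφ : Fin N → L2Circ} (h : ∀ j, InSobolev l (φ j) (dφ j)) :
    ∀ᵐ x : Circ, ∀ ξ : Fin N → ℝ, (∑ j, ξ j * φ j x) ^ 2 ≤
      c l * ‖∑ j, ξ j • φ j‖ ^ (2 - 1 / l) * ‖∑ j, ξ j • dφ j‖ ^ (1 / l) -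
        κ * ‖∑ j, ξ j • φ j‖ ^ 2 := by
  have hl0 : 0 < l := by linarith
  have hl1 : 0 ≤ 2 - 1 / l := by
    have : 1 / l < 2 := by rw [div_lt_iff₀ hl0]; linarith
    linarith
  have hl2 : 0 ≤ 1 / l := by positivity
  have hae : ∀ᵐ x : Circ, ∀ n : ℕ,
      (∑ j, TopologicalSpace.denseSeq (Fin N → ℝ) n j * φ j x) ^ 2 ≤
      c l * ‖∑ j, TopologicalSpace.denseSeq (Fin N → ℝ) n j • φ j‖ ^ (2 - 1 / l) *
        ‖∑ j, TopologicalSpace.denseSeq (Fin N → ℝ) n j • dφ j‖ ^ (1 / l) -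
        κ * ‖∑ j, TopologicalSpace.denseSeq (Fin N → ℝ) n j • φ j‖ ^ 2 := by
    refine ae_all_iff.2 fun n => ?_
    filter_upwards [hκ _ _ (InSobolev.sum_smul h (TopologicalSpace.denseSeq (Fin N → ℝ) n)),
      coeFn_sum_smul (TopologicalSpace.denseSeq (Fin N → ℝ) n) φ] with x hx hx2
    rwa [hx2] at hx
  filter_upwards [hae] with x hx ξ
  -- The null set is chosen for a countable dense set of `ξ`; both sides are continuous in `ξ`, as
  -- the exponents are nonnegative.
  refine (TopologicalSpace.denseRange_denseSeq (Fin N → ℝ)).induction_on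
    (p := fun ξ => (∑ j, ξ j * φ j x) ^ 2 ≤
      c l * ‖∑ j, ξ j • φ j‖ ^ (2 - 1 / l) * ‖∑ j, ξ j • dφ j‖ ^ (1 / l) -
        κ * ‖∑ j, ξ j • φ j‖ ^ 2) ξ (isClosed_le (by fun_prop) ?_) hx
  have h1 : Continuous fun ξ : Fin N → ℝ => ‖∑ j, ξ j • φ j‖ := by fun_prop
  have h2 : Continuous fun ξ : Fin N → ℝ => ‖∑ j, ξ j • dφ j‖ := by fun_prop
  exact ((continuous_const.mul (h1.rpow_const fun _ => Or.inr hl1)).mul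
    (h2.rpow_const fun _ => Or.inr hl2)).sub (continuous_const.mul (h1.pow 2))

/-- The algebra behind the pointwise inequality for `ρ`. -/
lemma rpow_add_mul_rpow_le {l κ C ρ D : ℝ} (hl : 1 / 2 < l) (hκ : 0 ≤ κ) (hC : 0 ≤ C)
    (hρ : 0 ≤ ρ) (hD : 0 ≤ D)
    (h : ρ ^ 2 ≤ C * √ρ ^ (2 - 1 / l) * D ^ (1 / l) - κ * √ρ ^ 2) :
    ρ ^ (2 * l + 1) + ρ * κ ^ (2 * l) ≤ C ^ (2 * l) * D ^ 2 := by
  have hl0 : 0 < l := by linarith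
  rcases hρ.eq_or_lt with rfl | hρ0
  · rw [Real.zero_rpow (by linarith)]
    simp only [zero_mul, add_zero]
    positivity
  have hsq : √ρ ^ 2 = ρ := Real.sq_sqrt hρ
  have hpow : √ρ ^ (2 - 1 / l) = ρ / ρ ^ (1 / (2 * l)) := by
    rw [Real.sqrt_eq_rpow, ← Real.rpow_mul hρ, show 1 / 2 * (2 - 1 / l) = 1 - 1 / (2 * l) by
      field_simp, Real.rpow_sub hρ0, Real.rpow_one]
  have hρp : 0 < ρ ^ (1 / (2 * l)) := Real.rpow_pos_of_pos hρ0 _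
  rw [hsq, hpow] at h
  have h1 : (ρ + κ) * ρ ^ (1 / (2 * l)) ≤ C * D ^ (1 / l) := by
    have h2 : ρ * (ρ + κ) ≤ ρ * (C * D ^ (1 / l) / ρ ^ (1 / (2 * l))) := by
      calc ρ * (ρ + κ) = ρ ^ 2 + κ * ρ := by ring
        _ ≤ C * (ρ / ρ ^ (1 / (2 * l))) * D ^ (1 / l) := by linarith
        _ = _ := by ring
    exact (le_div_iff₀ hρp).1 (le_of_mul_le_mul_left h2 hρ0)
  have h3 := Real.rpow_le_rpow (by positivity) h1 (show 0 ≤ 2 * l by linarith)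
  rw [Real.mul_rpow (by positivity) hρp.le, Real.mul_rpow hC (by positivity),
    ← Real.rpow_mul hρ, ← Real.rpow_mul hD, show 1 / (2 * l) * (2 * l) = 1 by field_simp,
    show 1 / l * (2 * l) = 2 by field_simp, Real.rpow_one, Real.rpow_two] at h3
  refine le_trans ?_ h3
  -- Superadditivity of `x ↦ x^{2l}`, valid since `2l ≥ 1`, separates the correction term.
  have h4 := Real.add_rpow_le_rpow_add hρ hκ (show 1 ≤ 2 * l by linarith)
  rw [Real.rpow_add_one hρ0.ne']
  calc _ = (ρ ^ (2 * l) + κ ^ (2 * l)) * ρ := by ring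
    _ ≤ _ := by gcongr

lemma rho_nonneg {N : ℕ} (φ : Fin N → L2Circ) (x : Circ) : 0 ≤ rho φ x :=
  Finset.sum_nonneg fun _ _ => sq_nonneg _

lemma integrable_mul_coeFn (f g : L2Circ) : Integrable fun x : Circ => f x * g x := by
  have := L2.integrable_inner (𝕜 := ℝ) f g
  refine this.congr (ae_of_all _ fun x => ?_)
  simp [mul_comm]

lemma integral_mul_coeFn (f g : L2Circ) : ∫ x : Circ, f x * g x = inner ℝ f g := by
  rw [L2.inner_def]
  exact integral_congr_ae (ae_of_all _ fun x => by simp [mul_comm])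

lemma norm_sum_smul_sq_eq {ι : Type*} [Fintype ι] (ξ : ι → ℝ) (g : ι → L2Circ) :
    ‖∑ j, ξ j • g j‖ ^ 2 = ∑ i, ∑ j, ξ i * ξ j * inner ℝ (g i) (g j) := by
  rw [← real_inner_self_eq_norm_sq, sum_inner]
  refine Finset.sum_congr rfl fun i _ => ?_
  rw [inner_sum]
  refine Finset.sum_congr rfl fun j _ => ?_
  rw [real_inner_smul_left, real_inner_smul_right]
  ring

lemma integrable_norm_sum_smul_sq {N : ℕ} (φ dφ : Fin N → L2Circ) :
    Integrable fun x : Circ => ‖∑ j, φ j x • dφ j‖ ^ 2 := by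
  simp only [norm_sum_smul_sq_eq]
  exact integrable_finsetSum _ fun i _ => integrable_finsetSum _ fun j _ =>
    (integrable_mul_coeFn (φ i) (φ j)).mul_const _

/-- After expanding the square, integration replaces `φᵢ φⱼ` by `δᵢⱼ`, so the off-diagonal inner
products of the derivatives drop out. -/
lemma integral_norm_sum_smul_sq {N : ℕ} {φ : Fin N → L2Circ} (hφ : Orthonormal ℝ φ)
    (dφ : Fin N → L2Circ) :
    ∫ x : Circ, ‖∑ j, φ j x • dφ j‖ ^ 2 = ∑ j, ‖dφ j‖ ^ 2 := by
  simp only [norm_sum_smul_sq_eq]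
  have hint : ∀ i j, Integrable (fun x : Circ => φ i x * φ j x * inner ℝ (dφ i) (dφ j)) :=
    fun i j => (integrable_mul_coeFn (φ i) (φ j)).mul_const _
  rw [integral_finsetSum _ fun i _ => integrable_finsetSum _ fun j _ => hint i j]
  refine Finset.sum_congr rfl fun i _ => ?_
  rw [integral_finsetSum _ fun j _ => hint i j]
  simp only [integral_mul_const, integral_mul_coeFn, orthonormal_iff_ite.1 hφ]
  simp

lemma integrable_rho {N : ℕ} (φ : Fin N → L2Circ) : Integrable (rho φ) :=
  integrable_finsetSum _ fun j _ => by
    simpa [sq] using integrable_mul_coeFn (φ j) (φ j)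

lemma integral_rho {N : ℕ} {φ : Fin N → L2Circ} (hφ : Orthonormal ℝ φ) :
    ∫ x : Circ, rho φ x = N := by
  unfold rho
  rw [integral_finsetSum _ fun j _ => by simpa [sq] using integrable_mul_coeFn (φ j) (φ j)]
  simp only [← norm_sq_eq_integral, hφ.1]
  simp

lemma lieb_thirring {l : ℝ} (hl : 1 / 2 < l) {N : ℕ} {φ dφ : Fin N → L2Circ}
    (hφ : Orthonormal ℝ φ) (h : ∀ j, InSobolev l (φ j) (dφ j)) :
    Integrable (fun x : Circ => rho φ x ^ (2 * l + 1)) volume ∧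
      (∫ x : Circ, rho φ x ^ (2 * l + 1)) + (N : ℝ) * K l ^ (2 * l)
        ≤ c l ^ (2 * l) * ∑ j, ‖dφ j‖ ^ 2 := by
  have hK := (K_pos hl).le
  have hpt : ∀ᵐ x : Circ, rho φ x ^ (2 * l + 1) + rho φ x * K l ^ (2 * l) ≤
      c l ^ (2 * l) * ‖∑ j, φ j x • dφ j‖ ^ 2 := by
    filter_upwards [ae_forall_sum_le hl (correctedIneq_K hl) h] with x hx
    -- The coefficients depend on `x` itself, which is why one null set for all `ξ` was needed.
    have h1 := hx fun j => φ j x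
    have h2 : ‖∑ j, φ j x • φ j‖ = √(rho φ x) := by
      rw [rho, ← norm_sum_smul_sq hφ fun j => φ j x, Real.sqrt_sq (norm_nonneg _)]
    have h3 : ∑ j, φ j x * φ j x = rho φ x := Finset.sum_congr rfl fun j _ => (sq _).symm
    rw [h2, h3] at h1
    exact rpow_add_mul_rpow_le hl hK (c_pos hl).le (rho_nonneg φ x) (norm_nonneg _) h1
  have hdom := (integrable_norm_sum_smul_sq φ dφ).const_mul (c l ^ (2 * l))
  have hρ := integrable_rho φ
  have hint : Integrable (fun x : Circ => rho φ x ^ (2 * l + 1)) volume := by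
    refine hdom.mono' ?_ ?_
    · exact (hρ.aestronglyMeasurable.aemeasurable.pow_const _).aestronglyMeasurable
    · filter_upwards [hpt] with x hx
      have h0 := rho_nonneg φ x
      rw [Real.norm_of_nonneg (Real.rpow_nonneg h0 _)]
      have : 0 ≤ rho φ x * K l ^ (2 * l) := by positivity
      linarith
  refine ⟨hint, ?_⟩
  have := integral_mono_ae (hint.add (hρ.mul_const (K l ^ (2 * l)))) hdom hpt
  rw [integral_add' hint (hρ.mul_const _), integral_mul_const, integral_rho hφ,
    integral_const_mul, integral_norm_sum_smul_sq hφ] at this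
  exact this

end LiebThirring

end

theorem theorem3p1 :
    -- the general inequality, with a correction constant that is positive
    (∀ l : ℝ, 1 / 2 < l →
      0 < LiebThirring.K l ∧
      ∀ (N : ℕ) (φ dφ : Fin N → LiebThirring.L2Circ),
        Orthonormal ℝ φ → (∀ j, LiebThirring.InSobolev l (φ j) (dφ j)) →
        Integrable (fun x : LiebThirring.Circ => LiebThirring.rho φ x ^ (2 * l + 1)) volume ∧
        (∫ x : LiebThirring.Circ, LiebThirring.rho φ x ^ (2 * l + 1)) +
            (N : ℝ) * LiebThirring.K l ^ (2 * l)
          ≤ LiebThirring.c l ^ (2 * l) * ∑ j, ‖dφ j‖ ^ 2) ∧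
    -- its explicit form for `l = 1`
    LiebThirring.K 1 = 1 / π ∧
    (∀ (N : ℕ) (φ dφ : Fin N → LiebThirring.L2Circ),
        Orthonormal ℝ φ → (∀ j, LiebThirring.InSobolev 1 (φ j) (dφ j)) →
        Integrable (fun x : LiebThirring.Circ => LiebThirring.rho φ x ^ 3) volume ∧
        (∫ x : LiebThirring.Circ, LiebThirring.rho φ x ^ 3) + (N : ℝ) / π ^ 2
          ≤ ∑ j, ‖dφ j‖ ^ 2) := by
  refine ⟨fun l hl => ⟨LiebThirring.K_pos hl, fun N φ dφ hφ h =>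
    LiebThirring.lieb_thirring hl hφ h⟩, LiebThirring.K_one, fun N φ dφ hφ h => ?_⟩
  have h1 := LiebThirring.lieb_thirring (by norm_num) hφ h
  have h3 : ∀ y : ℝ, y ^ (2 * (1 : ℝ) + 1) = y ^ 3 := fun y => by
    rw [← Real.rpow_natCast]
    norm_num
  have h2 : (2 : ℝ) * 1 = (2 : ℕ) := by norm_num
  simp only [h3] at h1
  rw [LiebThirring.K_one, LiebThirring.c_one, h2, Real.rpow_natCast, Real.one_rpow, one_mul] at h1
  rwa [div_pow, one_pow, mul_one_div] at h1
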